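/- Let $I_0=[0,1)$ and let $\mathcal D^4$ be the set of 4-adic intervals $I=[k4^{-n},(k+1)4^{-n})\subset I_0$, $n\ge 0$, $0\le k<4^n$. For $I\in\mathcal D^4$ let $I^y$ be the left half and $I^x$ the right half of $I$, and for $\star\in\{x,y\}$ let $I^\star_-$, $I^\star_+$ be the left and right halves of $I^\star$, so that the four quarters $I^\star_\pm$ of $I$ belong to $\mathcal D^4$. For a family $(U_I)_{I\in\mathcal D^4}$ put $\Delta^\star U_I=\frac12(U_{I^\star_+}-U_{I^\star_-})$. A sliced dyadic supermartingale is a real family $M=(M_I)_{I\in\mathcal D^4}$ with $$M_I\ \ge\ \tfrac12\big(M_{I^x_+}+M_{I^x_-}\big)=\tfrac12\big(M_{I^y_+}+M_{I^y_-}\big)\qquad\text{for all } I\in\mathcal D^4;$$ put $\Delta^{\mathrm{dy}}M_I=\frac12(M_{I^x_+}+M_{I^x_-})-M_I$ and $\|M\|_\infty=\sup_I|M_I|$. The dyadic Hardy space $H^2_{\mathrm{dy}}$ consists of the $f=u+iv$ with $u,v\in L^2(I_0)$ real-valued, whose averages $u_I=\frac1{|I|}\int_I u$, $v_I=\frac1{|I|}\int_I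 v$ are sliced martingales, that is, $\frac12(u_{I^\star_+}+u_{I^\star_-})=u_I$ and $\frac12(v_{I^\star_+}+v_{I^\star_-})=v_I$ for $\star=x,y$, and satisfy the dyadic Cauchy-Riemann equations $\Delta^xu_I=\Delta^yv_I$, $\Delta^yu_I=-\Delta^xv_I$, for all $I\in\mathcal D^4$. Its norm is given by $\|f\|^2=\int_{I_0}(u^2+v^2)$. **Theorem.** (1) Let $M$ be a bounded non-negative sliced dyadic supermartingale and let $\mu_I=-|I|\,\Delta^{\mathrm{dy}}M_I$. Then for all $f=u+iv\in H^2_{\mathrm{dy}}$ $$\sum_{I\in\mathcal D^4}\mu_I\,(u_I^2+v_I^2)\ \le\ e\,\|M\|_\infty\,\|f\|^2 .$$ (2) The constant $e$ in (1) is sharp: for every $C<e$ there are such an $M$ and an $f=u+iv\in H^2_{\mathrm{dy}}$, which can be taken with $v_{I_0}=0$, such that $\sum_{I}\mu_I(u_I^2+v_I^2)>C\,\|M\|_\infty\,\|f\|^2$. (3) Let $\mu=(\mu_I)_{I\in\mathcal D^4}$ be a non-negative sequence with $\sum_{I\in\mathcal D^4}\mu_I<\infty$ which is balanced, that is, for all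 $I\in\mathcal D^4$ $$\frac1{|I^x|}\sum_{J\in\mathcal D^4,\,J\subseteq I^x}\mu_J=\frac1{|I^y|}\sum_{J\in\mathcal D^4,\,J\subseteq I^y}\mu_J=\frac1{|I|}\sum_{J\in\mathcal D^4,\,J\subseteq I}\mu_J-\frac{\mu_I}{|I|},$$ and suppose that $K$ is a packing constant of $\mu$, that is, $\frac1{|I|}\sum_{J\in\mathcal D^4,\,J\subseteq I}\mu_J\le K$ for all $I\in\mathcal D^4$. Then for all $f=u+iv\in H^2_{\mathrm{dy}}$ $$\sum_{I\in\mathcal D^4}\mu_I\,(u_I^2+v_I^2)\ \le\ e\,K\,\|f\|^2 .$$ (4) The constant $e$ in (3) is sharp: for every $C<e$ there are $\mu$ and $K$ as in (3) and an $f=u+iv\in H^2_{\mathrm{dy}}$, which can be taken with $v_{I_0}=0$, such that $\sum_{I}\mu_I(u_I^2+v_I^2)>C\,K\,\|f\|^2$. -/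

import Mathlib

open MeasureTheory

namespace DyadicHardy

/-- A 4-adic subinterval of `I₀ = [0, 1)`: the pair `(n, k)` with `k < 4 ^ n` stands for the interval
`[k 4⁻ⁿ, (k + 1) 4⁻ⁿ)`. -/
@[ext]
structure FourAdic where
  level : ℕ
  pos : ℕ
  pos_lt : pos < 4 ^ level

namespace FourAdic

/-- The interval `I₀ = [0, 1)`. -/
def root : FourAdic := ⟨0, 0, by norm_num⟩

/-- The length `|I|`. -/
noncomputable def length (I : FourAdic) : ℝ := 1 / 4 ^ I.level

/-- The left end point of `I`. -/
noncomputable def left (I : FourAdic) : ℝ := I.pos / 4 ^ I.level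

/-- The set of points of `I`. -/
def toSet (I : FourAdic) : Set ℝ := Set.Ico I.left (I.left + I.length)

/-- The left half `I^y = I_-` of `I`. -/
def yHalf (I : FourAdic) : Set ℝ := Set.Ico I.left (I.left + I.length / 2)

/-- The right half `I^x = I_+` of `I`. -/
def xHalf (I : FourAdic) : Set ℝ := Set.Ico (I.left + I.length / 2) (I.left + I.length)

/-- The quarters of `I`, numbered `0, 1, 2, 3` from left to right. -/
def child (I : FourAdic) (j : Fin 4) : FourAdic :=
  ⟨I.level + 1, 4 * I.pos + j, by
    have h := I.pos_lt
    have hj := j.isLt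
    rw [pow_succ]
    omega⟩

/-- `I^y_-`, the left half of `I^y`. -/
def yMinus (I : FourAdic) : FourAdic := I.child 0

/-- `I^y_+`, the right half of `I^y`. -/
def yPlus (I : FourAdic) : FourAdic := I.child 1

/-- `I^x_-`, the left half of `I^x`. -/
def xMinus (I : FourAdic) : FourAdic := I.child 2

/-- `I^x_+`, the right half of `I^x`. -/
def xPlus (I : FourAdic) : FourAdic := I.child 3

end FourAdic

/-- The mean of `U` over the two children of `I` inside `I^x`. -/
noncomputable def xMean (U : FourAdic → ℝ) (I : FourAdic) : ℝ := (U I.xPlus + U I.xMinus) / 2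

/-- The mean of `U` over the two children of `I` inside `I^y`. -/
noncomputable def yMean (U : FourAdic → ℝ) (I : FourAdic) : ℝ := (U I.yPlus + U I.yMinus) / 2

/-- The increment `Δˣ U_I`. -/
noncomputable def deltaX (U : FourAdic → ℝ) (I : FourAdic) : ℝ := (U I.xPlus - U I.xMinus) / 2

/-- The increment `Δʸ U_I`. -/
noncomputable def deltaY (U : FourAdic → ℝ) (I : FourAdic) : ℝ := (U I.yPlus - U I.yMinus) / 2

/-- Sliced dyadic martingales, indexed by the 4-adic intervals. -/
def IsSlicedMartingale (U : FourAdic → ℝ) : Prop :=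
  ∀ I, xMean U I = U I ∧ yMean U I = U I

/-- Sliced dyadic supermartingales, indexed by the 4-adic intervals. -/
def IsSlicedSupermartingale (M : FourAdic → ℝ) : Prop :=
  ∀ I, xMean M I = yMean M I ∧ xMean M I ≤ M I

/-- The dyadic Laplacian `Δ^dy M_I` of a sliced family (for which `xMean` and `yMean` agree). -/
noncomputable def dyLaplacian (M : FourAdic → ℝ) (I : FourAdic) : ℝ := xMean M I - M I

/-- The weights `μ_I` with `μ_I / |I| = - Δ^dy M_I`. -/
noncomputable def rieszWeight (M : FourAdic → ℝ) (I : FourAdic) : ℝ :=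
  I.length * (-dyLaplacian M I)

/-- The dyadic Cauchy-Riemann equations. -/
def CauchyRiemann (U V : FourAdic → ℝ) : Prop :=
  ∀ I, deltaX U I = deltaY V I ∧ deltaY U I = -deltaX V I

/-- The average `u_I = ⟨u⟩_I` over a 4-adic interval. -/
noncomputable def avg (u : ℝ → ℝ) (I : FourAdic) : ℝ := ⨍ t in I.toSet, u t

/-- Membership of `f = u + i v` in the dyadic Hardy space `H²_dy`; `u` and `v` are the `L²` limits
on `[0, 1)` of the martingales `(u_I)` and `(v_I)`. -/
structure MemHardy (u v : ℝ → ℝ) : Prop where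
  memLp_re : MemLp u 2 (volume.restrict (Set.Ico 0 1))
  memLp_im : MemLp v 2 (volume.restrict (Set.Ico 0 1))
  sliced_re : IsSlicedMartingale (avg u)
  sliced_im : IsSlicedMartingale (avg v)
  cauchyRiemann : CauchyRiemann (avg u) (avg v)

/-- The square of the norm of `f = u + i v` in `H²_dy`. -/
noncomputable def hardyNormSq (u v : ℝ → ℝ) : ℝ := ∫ t in Set.Ico (0 : ℝ) 1, (u t ^ 2 + v t ^ 2)

/-- `∑ μ_J` over the 4-adic intervals `J` contained in `S`. -/
noncomputable def massIn (μ : FourAdic → ℝ) (S : Set ℝ) : ℝ :=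
  ∑' J : {J : FourAdic // J.toSet ⊆ S}, μ J

/-- Balanced non-negative sequences. Summability says that the sums in the balance condition are
finite; it also follows from any packing condition. -/
structure IsBalanced (μ : FourAdic → ℝ) : Prop where
  nonneg : ∀ I, 0 ≤ μ I
  summable : Summable μ
  x_eq_y : ∀ I : FourAdic,
    1 / (I.length / 2) * massIn μ I.xHalf = 1 / (I.length / 2) * massIn μ I.yHalf
  y_eq : ∀ I : FourAdic,
    1 / (I.length / 2) * massIn μ I.yHalf = 1 / I.length * massIn μ I.toSet - μ I / I.length

/-- The packing condition with constant `K`. -/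
def Packing (μ : FourAdic → ℝ) (K : ℝ) : Prop :=
  ∀ I : FourAdic, 1 / I.length * massIn μ I.toSet ≤ K

end DyadicHardy

open DyadicHardy

/-!
By homogeneity let `0 ≤ M ≤ 1`. The discounted energies `∑ |I| exp (-M_I) |f_I|²` over the intervals
of level `n` are nondecreasing in `n` and bounded by `‖f‖²`. Indeed, if `M_I` equals the mean
of `M` over the quarters of `I`, then the Cauchy-Riemann equations turn the claim into the
inequality `four_mul_le_sum_exp`; if `M` drops on average by `-Δ^dy M_I`, then
`exp t ≥ 1 + t` yields an additional gain of at least `exp (-M_I) μ_I |f_I|²`. Adding up the gains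
and using `exp (-M_I) ≥ exp (-1)` gives the constant `e`. A balanced sequence `μ` consists of the
weights of the supermartingale `I ↦ |I|⁻¹ ∑_{J ⊆ I} μ_J`.

For sharpness, all these inequalities have to be almost equalities. Let `M` walk on the heights
`k / N`, starting at `1` and absorbed at `0`: in between it moves by `±1 / N` on the quarters of
`I^x`, where `f` is multiplied by `1 ± tanh (1 / (2 * N))`, and stays put on those of `I^y`, where
`f` is multiplied by `1 ± i tanh (1 / (2 * N))`; this is an equality case of `four_mul_le_sum_exp`.
At height `1` the walk drops by `1 / N` on all quarters and the energy grows by the factor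
`exp (1 / N)`. Under the energy-weighted measure the height is a lazy simple random walk, which is
absorbed at `0`, where no discount is left, and the ratio of the two sides of the embedding tends
to `exp (1 - 1 / N)`.
-/

namespace DyadicHardy

namespace FourAdic

theorem length_pos (I : FourAdic) : 0 < I.length := by
  unfold length
  positivity

theorem length_root : root.length = 1 := by
  simp [length, root]

theorem length_child (I : FourAdic) (j : Fin 4) : (I.child j).length = I.length / 4 := by
  simp only [length, child, pow_succ]
  field_simp

theorem left_child (I : FourAdic) (j : Fin 4) :
    (I.child j).left = I.left + j * (I.length / 4) := by
  simp only [length, left, child, pow_succ]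
  push_cast
  field_simp

theorem toSet_eq_Ico_div (I : FourAdic) :
    I.toSet = Set.Ico ((I.pos : ℝ) / 4 ^ I.level) ((I.pos + 1 : ℕ) / 4 ^ I.level) := by
  rw [toSet, left, length, ← add_div, Nat.cast_add_one]

theorem toSet_root : root.toSet = Set.Ico 0 1 := by
  simp [toSet, root, left, length]

theorem toSet_subset_toSet_root (I : FourAdic) : I.toSet ⊆ root.toSet := by
  rw [toSet_root, toSet_eq_Ico_div]
  refine Set.Ico_subset_Ico (by positivity) ((div_le_one (by positivity)).2 ?_)
  exact_mod_cast I.pos_lt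

theorem measurableSet_toSet (I : FourAdic) : MeasurableSet I.toSet := measurableSet_Ico

theorem volume_real_toSet (I : FourAdic) : volume.real I.toSet = I.length := by
  simp [toSet, I.length_pos.le]

theorem induction_of_level_ge {P : FourAdic → Prop} (n : ℕ) (base : ∀ I, n ≤ I.level → P I)
    (step : ∀ I, I.level < n → (∀ j, P (I.child j)) → P I) (I : FourAdic) : P I := by
  induction hd : n - I.level generalizing I with
  | zero => exact base I (Nat.sub_eq_zero_iff_le.1 hd)
  | succ d ih =>
    refine step I (by omega) fun j => ih _ ?_
    change n - (I.level + 1) = d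
    omega

/-- The enumeration of the 4-adic intervals by level and position. -/
def equivSigma : (Σ n : ℕ, Fin (4 ^ n)) ≃ FourAdic where
  toFun x := ⟨x.1, x.2, x.2.isLt⟩
  invFun I := ⟨I.level, ⟨I.pos, I.pos_lt⟩⟩

end FourAdic

open FourAdic

theorem apply_xMinus (U : FourAdic → ℝ) (I : FourAdic) :
    U I.xMinus = xMean U I - deltaX U I := by
  unfold xMean deltaX
  ring

theorem apply_xPlus (U : FourAdic → ℝ) (I : FourAdic) :
    U I.xPlus = xMean U I + deltaX U I := by
  unfold xMean deltaX
  ring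

theorem apply_yMinus (U : FourAdic → ℝ) (I : FourAdic) :
    U I.yMinus = yMean U I - deltaY U I := by
  unfold yMean deltaY
  ring

theorem apply_yPlus (U : FourAdic → ℝ) (I : FourAdic) :
    U I.yPlus = yMean U I + deltaY U I := by
  unfold yMean deltaY
  ring

theorem sum_child (G : FourAdic → ℝ) (I : FourAdic) :
    ∑ j, G (I.child j) = G I.yMinus + G I.yPlus + G I.xMinus + G I.xPlus :=
  Fin.sum_univ_four _

theorem sum_child_eq_means (G : FourAdic → ℝ) (I : FourAdic) :
    ∑ j, G (I.child j) = 2 * (xMean G I + yMean G I) := by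
  rw [sum_child, xMean, yMean]
  ring

/-! ### Sums over levels -/

/-- The sum of `G` over the intervals of level `n`. -/
noncomputable def levelSum (n : ℕ) (G : FourAdic → ℝ) : ℝ :=
  ∑ k : Fin (4 ^ n), G (equivSigma ⟨n, k⟩)

theorem levelSum_zero (G : FourAdic → ℝ) : levelSum 0 G = G root := by
  have h (k : Fin (4 ^ 0)) : equivSigma ⟨0, k⟩ = root :=
    FourAdic.ext rfl (Nat.lt_one_iff.1 k.isLt)
  simp [levelSum, h]

theorem levelSum_succ (n : ℕ) (G : FourAdic → ℝ) :
    levelSum (n + 1) G = levelSum n fun I => ∑ j, G (I.child j) := by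
  unfold levelSum
  rw [← Fintype.sum_prod_type',
    ← (finProdFinEquiv.trans (finCongr (pow_succ 4 n).symm)).sum_comp]
  refine Finset.sum_congr rfl fun x _ => congrArg G (FourAdic.ext rfl ?_)
  simp [equivSigma, child, add_comm]

theorem levelSum_mono {n : ℕ} {G H : FourAdic → ℝ} (h : ∀ I, I.level = n → G I ≤ H I) :
    levelSum n G ≤ levelSum n H :=
  Finset.sum_le_sum fun _ _ => h _ rfl

theorem levelSum_congr {n : ℕ} {G H : FourAdic → ℝ} (h : ∀ I, I.level = n → G I = H I) :
    levelSum n G = levelSum n H :=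
  Finset.sum_congr rfl fun _ _ => h _ rfl

theorem levelSum_nonneg {n : ℕ} {G : FourAdic → ℝ} (h : ∀ I, I.level = n → 0 ≤ G I) :
    0 ≤ levelSum n G :=
  Finset.sum_nonneg fun _ _ => h _ rfl

theorem levelSum_add (n : ℕ) (G H : FourAdic → ℝ) :
    levelSum n (fun I => G I + H I) = levelSum n G + levelSum n H :=
  Finset.sum_add_distrib

theorem levelSum_const_mul (n : ℕ) (c : ℝ) (G : FourAdic → ℝ) :
    levelSum n (fun I => c * G I) = c * levelSum n G :=
  (Finset.mul_sum _ _ _).symm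

theorem abs_le_levelSum_abs (G : FourAdic → ℝ) (I : FourAdic) :
    |G I| ≤ levelSum I.level fun J => |G J| :=
  Finset.single_le_sum (f := fun k => |G (equivSigma ⟨I.level, k⟩)|)
    (fun _ _ => abs_nonneg _) (Finset.mem_univ (⟨I.pos, I.pos_lt⟩ : Fin (4 ^ I.level)))

theorem summable_iff_summable_levelSum {g : FourAdic → ℝ} (hg : ∀ I, 0 ≤ g I) :
    Summable g ↔ Summable fun n => levelSum n g := by
  rw [← equivSigma.summable_iff, summable_sigma_of_nonneg (f := g ∘ equivSigma) fun _ => hg _]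
  simp [levelSum, Summable.of_finite]

theorem tsum_eq_tsum_levelSum {g : FourAdic → ℝ} (hg : Summable g) :
    ∑' I, g I = ∑' n, levelSum n g := by
  refine (equivSigma.tsum_eq g).symm.trans ((equivSigma.summable_iff.2 hg).tsum_sigma.trans ?_)
  simp [levelSum]

theorem summable_and_tsum_le_of_sum_levelSum_le {g : FourAdic → ℝ} {c : ℝ} (hg : ∀ I, 0 ≤ g I)
    (h : ∀ n, ∑ m ∈ Finset.range n, levelSum m g ≤ c) : Summable g ∧ ∑' I, g I ≤ c := by
  have hlevel (n : ℕ) : 0 ≤ levelSum n g := levelSum_nonneg fun I _ => hg I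
  have hs : Summable g :=
    (summable_iff_summable_levelSum hg).2 (summable_of_sum_range_le hlevel h)
  exact ⟨hs, (tsum_eq_tsum_levelSum hs).trans_le (Real.tsum_le_of_sum_range_le hlevel h)⟩

theorem sum_levelSum_le_tsum {g : FourAdic → ℝ} (hg : ∀ I, 0 ≤ g I) (hs : Summable g) (n : ℕ) :
    ∑ m ∈ Finset.range n, levelSum m g ≤ ∑' I, g I := by
  rw [tsum_eq_tsum_levelSum hs]
  exact ((summable_iff_summable_levelSum hg).1 hs).sum_le_tsum _
    fun m _ => levelSum_nonneg fun I _ => hg I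

/-! ### Averages -/

theorem integral_toSet_eq_sum_child {w : ℝ → ℝ} {I : FourAdic} (hw : IntegrableOn w I.toSet) :
    ∫ t in I.toSet, w t = ∑ j, ∫ t in (I.child j).toSet, w t := by
  have hl := I.length_pos
  let a : ℕ → ℝ := fun k => I.left + k * (I.length / 4)
  have ha : Monotone a := fun k l hkl => by
    dsimp only [a]
    gcongr
  have ha4 : a 4 = I.left + I.length := by
    simp only [a]
    push_cast
    ring
  have hchild (j : Fin 4) : (I.child j).toSet = Set.Ico (a j) (a (j + 1)) := by
    simp only [toSet, left_child, length_child, a]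
    congr 1
    push_cast
    ring
  have hI : I.toSet = Set.Ico (a 0) (a 4) := by
    simp [toSet, ha4, a]
  have hintegrable : ∀ k < 4, IntervalIntegrable w volume (a k) (a (k + 1)) := fun k hk => by
    rw [intervalIntegrable_iff_integrableOn_Ico_of_le (ha k.le_succ)]
    exact hw.mono_set (hI ▸ Set.Ico_subset_Ico (ha k.zero_le) (ha hk))
  simp only [hchild, hI, integral_Ico_eq_integral_Ioc]
  rw [← intervalIntegral.integral_of_le (ha (Nat.zero_le 4)),
    ← intervalIntegral.sum_integral_adjacent_intervals hintegrable, Finset.sum_range]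
  exact Finset.sum_congr rfl fun j _ => intervalIntegral.integral_of_le (ha (Nat.le_succ _))

theorem levelSum_integral {w : ℝ → ℝ} (hw : IntegrableOn w root.toSet) (n : ℕ) :
    levelSum n (fun I => ∫ t in I.toSet, w t) = ∫ t in root.toSet, w t := by
  induction n with
  | zero => rw [levelSum_zero]
  | succ n ih =>
    rw [levelSum_succ, ← ih]
    exact levelSum_congr fun I _ =>
      (integral_toSet_eq_sum_child (hw.mono_set I.toSet_subset_toSet_root)).symm

theorem length_mul_avg (u : ℝ → ℝ) (I : FourAdic) :
    I.length * avg u I = ∫ t in I.toSet, u t := by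
  rw [avg, setAverage_eq, volume_real_toSet, smul_eq_mul, mul_inv_cancel_left₀ I.length_pos.ne']

theorem avg_eq_sum_child {u : ℝ → ℝ} {I : FourAdic} (hu : IntegrableOn u I.toSet) :
    avg u I = (∑ j, avg u (I.child j)) / 4 := by
  have h := integral_toSet_eq_sum_child hu
  simp only [← length_mul_avg, length_child, ← Finset.mul_sum] at h
  refine mul_left_cancel₀ I.length_pos.ne' (h.trans ?_)
  ring

theorem avg_eq_of_forall_mem_eq {u : ℝ → ℝ} {c : ℝ} {I : FourAdic} (h : ∀ t ∈ I.toSet, u t = c) :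
    avg u I = c := by
  refine mul_left_cancel₀ I.length_pos.ne' ?_
  rw [length_mul_avg, setIntegral_congr_fun (measurableSet_toSet I) h, setIntegral_const,
    volume_real_toSet, smul_eq_mul]

theorem length_mul_avg_sq_le {u : ℝ → ℝ} {I : FourAdic}
    (hu : MemLp u 2 (volume.restrict I.toSet)) :
    I.length * avg u I ^ 2 ≤ ∫ t in I.toSet, u t ^ 2 := by
  have hfinite : volume I.toSet ≠ ⊤ := by simp [toSet]
  have hpos : volume I.toSet ≠ 0 := by simp [toSet, I.length_pos]
  have : IsFiniteMeasure (volume.restrict I.toSet) := isFiniteMeasure_restrict.2 hfinite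
  rw [← length_mul_avg]
  refine mul_le_mul_of_nonneg_left ?_ I.length_pos.le
  exact even_two.convexOn_pow.map_set_average_le (continuousOn_pow 2) isClosed_univ hpos hfinite
    (by simp) (hu.integrable one_le_two) hu.integrable_sq

section MemHardy

variable {u v : ℝ → ℝ}

theorem MemHardy.memLp_re_toSet (h : MemHardy u v) (I : FourAdic) :
    MemLp u 2 (volume.restrict I.toSet) :=
  h.memLp_re.mono_measure
    (Measure.restrict_mono_set volume (toSet_root ▸ I.toSet_subset_toSet_root))

theorem MemHardy.memLp_im_toSet (h : MemHardy u v) (I : FourAdic) :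
    MemLp v 2 (volume.restrict I.toSet) :=
  h.memLp_im.mono_measure
    (Measure.restrict_mono_set volume (toSet_root ▸ I.toSet_subset_toSet_root))

theorem MemHardy.hardyNormSq_eq_levelSum (h : MemHardy u v) (n : ℕ) :
    hardyNormSq u v =
      levelSum n fun I => (∫ t in I.toSet, u t ^ 2) + ∫ t in I.toSet, v t ^ 2 := by
  have hintegrable : IntegrableOn (fun t => u t ^ 2 + v t ^ 2) root.toSet :=
    (h.memLp_re_toSet root).integrable_sq.add (h.memLp_im_toSet root).integrable_sq
  rw [hardyNormSq, ← toSet_root, ← levelSum_integral hintegrable n]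
  exact levelSum_congr fun I _ =>
    integral_add (h.memLp_re_toSet I).integrable_sq (h.memLp_im_toSet I).integrable_sq

theorem MemHardy.levelSum_avg_sq_le (h : MemHardy u v) (n : ℕ) :
    levelSum n (fun I => I.length * (avg u I ^ 2 + avg v I ^ 2)) ≤ hardyNormSq u v := by
  rw [h.hardyNormSq_eq_levelSum n]
  refine levelSum_mono fun I _ => ?_
  rw [mul_add]
  exact add_le_add (length_mul_avg_sq_le (h.memLp_re_toSet I))
    (length_mul_avg_sq_le (h.memLp_im_toSet I))

end MemHardy

/-! ### Masses of 4-adic intervals -/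

namespace FourAdic

theorem toSet_subset_Ico_div_iff {J : FourAdic} {m p q : ℕ} (hm : m ≤ J.level) :
    J.toSet ⊆ Set.Ico ((p : ℝ) / 4 ^ m) (q / 4 ^ m) ↔
      p ≤ J.pos / 4 ^ (J.level - m) ∧ J.pos / 4 ^ (J.level - m) < q := by
  obtain ⟨d, hd⟩ := Nat.exists_eq_add_of_le hm
  have hrefine (k : ℕ) : (k : ℝ) / 4 ^ m = (k * 4 ^ d : ℕ) / 4 ^ J.level := by
    rw [hd, pow_add]
    push_cast
    field_simp
  have hne : (J.pos : ℝ) / 4 ^ J.level < (J.pos + 1 : ℕ) / 4 ^ J.level := by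
    gcongr
    exact J.pos.lt_succ_self
  rw [toSet_eq_Ico_div, Set.Ico_subset_Ico_iff hne, hrefine, hrefine,
    div_le_div_iff_of_pos_right (by positivity), div_le_div_iff_of_pos_right (by positivity),
    Nat.cast_le, Nat.cast_le, hd, Nat.add_sub_cancel_left, Nat.le_div_iff_mul_le (by positivity),
    Nat.div_lt_iff_lt_mul (by positivity), Nat.succ_le_iff]

theorem le_level_of_toSet_subset_Ico_div {J : FourAdic} {m p q : ℕ} (hq : q < p + 4)
    (h : J.toSet ⊆ Set.Ico ((p : ℝ) / 4 ^ m) (q / 4 ^ m)) : m ≤ J.level := by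
  have hpq : (q : ℝ) < p + 4 := by exact_mod_cast hq
  obtain ⟨hleft, hright⟩ :=
    (Set.Ico_subset_Ico_iff (lt_add_of_pos_right J.left J.length_pos)).1 h
  have hlength : 1 / (4 : ℝ) ^ J.level < 4 / 4 ^ m :=
    calc 1 / (4 : ℝ) ^ J.level ≤ q / 4 ^ m - p / 4 ^ m := by
          change J.length ≤ _
          linarith
      _ < 4 / 4 ^ m := by
          rw [← sub_div]
          gcongr
          linarith
  rw [div_lt_div_iff₀ (by positivity) (by positivity), one_mul, ← pow_succ'] at hlength
  exact Nat.lt_succ_iff.1 ((pow_lt_pow_iff_right₀ (by norm_num)).1 hlength)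

theorem yHalf_eq_Ico_div (I : FourAdic) :
    I.yHalf = Set.Ico ((4 * I.pos : ℕ) / 4 ^ (I.level + 1) : ℝ)
      ((4 * I.pos + 2 : ℕ) / 4 ^ (I.level + 1)) := by
  simp only [yHalf, left, length, pow_succ]
  push_cast
  congr 1
  · field_simp
  · field_simp
    ring

theorem xHalf_eq_Ico_div (I : FourAdic) :
    I.xHalf = Set.Ico ((4 * I.pos + 2 : ℕ) / 4 ^ (I.level + 1) : ℝ)
      ((4 * I.pos + 4 : ℕ) / 4 ^ (I.level + 1)) := by
  simp only [xHalf, left, length, pow_succ]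
  push_cast
  congr 1
  · field_simp
    ring
  · field_simp

theorem toSet_subset_toSet_iff {I J : FourAdic} :
    J.toSet ⊆ I.toSet ↔ J = I ∨ J.toSet ⊆ I.yHalf ∨ J.toSet ⊆ I.xHalf := by
  have hl := I.length_pos
  refine ⟨fun h => ?_, ?_⟩
  · have h' := h
    rw [toSet_eq_Ico_div I] at h'
    have hlevel := le_level_of_toSet_subset_Ico_div (by omega) h'
    rw [toSet_subset_Ico_div_iff hlevel] at h'
    rcases hlevel.eq_or_lt with heq | (hlt : I.level + 1 ≤ J.level)
    · left
      rw [heq, Nat.sub_self, pow_zero, Nat.div_one] at h'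
      exact FourAdic.ext heq.symm (by omega)
    · right
      rw [yHalf_eq_Ico_div, xHalf_eq_Ico_div, toSet_subset_Ico_div_iff hlt,
        toSet_subset_Ico_div_iff hlt]
      rw [show J.level - I.level = (J.level - (I.level + 1)) + 1 by omega, pow_succ,
        ← Nat.div_div_eq_div_mul] at h'
      omega
  · rintro (rfl | h | h)
    · exact subset_rfl
    · exact h.trans (Set.Ico_subset_Ico_right (by linarith))
    · exact h.trans (Set.Ico_subset_Ico_left (by linarith))

theorem lt_level_of_toSet_subset_yHalf {I J : FourAdic} (h : J.toSet ⊆ I.yHalf) :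
    I.level < J.level :=
  le_level_of_toSet_subset_Ico_div (by omega) (I.yHalf_eq_Ico_div ▸ h)

theorem lt_level_of_toSet_subset_xHalf {I J : FourAdic} (h : J.toSet ⊆ I.xHalf) :
    I.level < J.level :=
  le_level_of_toSet_subset_Ico_div (by omega) (I.xHalf_eq_Ico_div ▸ h)

theorem disjoint_setOf_toSet_subset {S T : Set ℝ} (h : Disjoint S T) :
    Disjoint {J : FourAdic | J.toSet ⊆ S} {J | J.toSet ⊆ T} := by
  refine Set.disjoint_left.2 fun J hS hT => ?_
  have hJ : J.left ∈ J.toSet := Set.left_mem_Ico.2 (lt_add_of_pos_right _ J.length_pos)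
  exact Set.disjoint_left.1 h (hS hJ) (hT hJ)

end FourAdic

section massIn

variable {μ : FourAdic → ℝ}

theorem massIn_nonneg (hμ : ∀ I, 0 ≤ μ I) (S : Set ℝ) : 0 ≤ massIn μ S :=
  tsum_nonneg fun J => hμ J

theorem massIn_Ico_div_add (hμ : Summable μ) {m p q r : ℕ} (hpq : p ≤ q) (hqr : q ≤ r)
    (hr : r < p + 4) :
    massIn μ (Set.Ico (p / 4 ^ m) (q / 4 ^ m)) + massIn μ (Set.Ico (q / 4 ^ m) (r / 4 ^ m)) =
      massIn μ (Set.Ico (p / 4 ^ m) (r / 4 ^ m)) := by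
  have hunion : {J : FourAdic | J.toSet ⊆ Set.Ico ((p : ℝ) / 4 ^ m) (r / 4 ^ m)} =
      {J | J.toSet ⊆ Set.Ico ((p : ℝ) / 4 ^ m) (q / 4 ^ m)} ∪
        {J | J.toSet ⊆ Set.Ico ((q : ℝ) / 4 ^ m) (r / 4 ^ m)} := by
    ext J
    by_cases hJ : m ≤ J.level
    · simp only [Set.mem_ofPred_eq, Set.mem_union, toSet_subset_Ico_div_iff hJ]
      omega
    · have hnot {a b : ℕ} (hab : b < a + 4) :
          ¬ J.toSet ⊆ Set.Ico ((a : ℝ) / 4 ^ m) (b / 4 ^ m) :=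
        fun h => hJ (le_level_of_toSet_subset_Ico_div hab h)
      simp only [Set.mem_ofPred_eq, Set.mem_union, hnot hr, hnot (show q < p + 4 by omega),
        hnot (show r < q + 4 by omega), or_self]
  change _ = ∑' J : {J : FourAdic | J.toSet ⊆ Set.Ico ((p : ℝ) / 4 ^ m) (r / 4 ^ m)}, μ J
  rw [hunion]
  exact ((hμ.subtype _).tsum_union_disjoint
    (disjoint_setOf_toSet_subset Set.Ico_disjoint_Ico_same) (hμ.subtype _)).symm

theorem massIn_yHalf (hμ : Summable μ) (I : FourAdic) :
    massIn μ I.yHalf = massIn μ I.yMinus.toSet + massIn μ I.yPlus.toSet := by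
  rw [yHalf_eq_Ico_div, toSet_eq_Ico_div, toSet_eq_Ico_div]
  exact (massIn_Ico_div_add hμ (p := 4 * I.pos) (q := 4 * I.pos + 1) (r := 4 * I.pos + 2)
    (by omega) (by omega) (by omega)).symm

theorem massIn_xHalf (hμ : Summable μ) (I : FourAdic) :
    massIn μ I.xHalf = massIn μ I.xMinus.toSet + massIn μ I.xPlus.toSet := by
  rw [xHalf_eq_Ico_div, toSet_eq_Ico_div, toSet_eq_Ico_div]
  exact (massIn_Ico_div_add hμ (p := 4 * I.pos + 2) (q := 4 * I.pos + 3) (r := 4 * I.pos + 4)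
    (by omega) (by omega) (by omega)).symm

theorem massIn_toSet (hμ : Summable μ) (I : FourAdic) :
    massIn μ I.toSet = μ I + (massIn μ I.yHalf + massIn μ I.xHalf) := by
  have hunion : {J : FourAdic | J.toSet ⊆ I.toSet} =
      {I} ∪ ({J | J.toSet ⊆ I.yHalf} ∪ {J | J.toSet ⊆ I.xHalf}) :=
    Set.ext fun J => toSet_subset_toSet_iff
  have hhalves : Disjoint I.yHalf I.xHalf := Set.Ico_disjoint_Ico_same
  have hself : Disjoint {I} ({J : FourAdic | J.toSet ⊆ I.yHalf} ∪ {J | J.toSet ⊆ I.xHalf}) := by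
    rw [Set.disjoint_singleton_left]
    rintro (h | h)
    · exact (lt_level_of_toSet_subset_yHalf h).false
    · exact (lt_level_of_toSet_subset_xHalf h).false
  change ∑' J : {J : FourAdic | J.toSet ⊆ I.toSet}, μ J = _
  rw [hunion, (hμ.subtype _).tsum_union_disjoint hself (hμ.subtype _), tsum_singleton,
    (hμ.subtype _).tsum_union_disjoint (disjoint_setOf_toSet_subset hhalves) (hμ.subtype _)]
  rfl

end massIn

/-! ### The embedding theorem -/

theorem four_mul_le_sum_exp (u v a b p q : ℝ) :
    4 * (u ^ 2 + v ^ 2) ≤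
      Real.exp q * ((u - b) ^ 2 + (v - a) ^ 2) + Real.exp (-q) * ((u + b) ^ 2 + (v + a) ^ 2) +
      Real.exp p * ((u - a) ^ 2 + (v + b) ^ 2) + Real.exp (-p) * ((u + a) ^ 2 + (v - b) ^ 2) := by
  have hp := Real.one_le_cosh p
  have hq := Real.one_le_cosh q
  have hsinh : p.sinh ^ 2 + q.sinh ^ 2 ≤ (p.cosh + q.cosh - 2) * (p.cosh + q.cosh) := by
    rw [Real.sinh_sq, Real.sinh_sq]
    linear_combination 2 * mul_nonneg (sub_nonneg.2 hp) (sub_nonneg.2 hq)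
  have hcross : (p.sinh * (u * a - v * b) + q.sinh * (u * b + v * a)) ^ 2 ≤
      ((p.cosh + q.cosh - 2) * (u ^ 2 + v ^ 2)) * ((p.cosh + q.cosh) * (a ^ 2 + b ^ 2)) :=
    calc (p.sinh * (u * a - v * b) + q.sinh * (u * b + v * a)) ^ 2
      _ ≤ (p.sinh ^ 2 + q.sinh ^ 2) * ((u ^ 2 + v ^ 2) * (a ^ 2 + b ^ 2)) := by
          linear_combination sq_nonneg (p.sinh * (u * b + v * a) - q.sinh * (u * a - v * b))
      _ ≤ ((p.cosh + q.cosh - 2) * (p.cosh + q.cosh)) * ((u ^ 2 + v ^ 2) * (a ^ 2 + b ^ 2)) := by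
          gcongr
      _ = _ := by ring
  have hamgm := two_mul_le_add_of_sq_le_mul
    (mul_nonneg (by linarith) (by positivity)) (mul_nonneg (by linarith) (by positivity)) hcross
  rw [← Real.cosh_sub_sinh p, ← Real.cosh_add_sinh p, ← Real.cosh_sub_sinh q,
    ← Real.cosh_add_sinh q]
  linear_combination 2 * hamgm

/-- The energy of the martingale `U + iV` on `I`, discounted by the height of `M`. -/
noncomputable def energy (M U V : FourAdic → ℝ) (I : FourAdic) : ℝ :=
  I.length * (Real.exp (-M I) * (U I ^ 2 + V I ^ 2))

section Supermartingale

variable {M U V : FourAdic → ℝ}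

theorem energy_nonneg (M U V : FourAdic → ℝ) (I : FourAdic) : 0 ≤ energy M U V I :=
  mul_nonneg I.length_pos.le (by positivity)

theorem rieszWeight_nonneg (hM : IsSlicedSupermartingale M) (I : FourAdic) :
    0 ≤ rieszWeight M I :=
  mul_nonneg I.length_pos.le (neg_nonneg.2 (sub_nonpos.2 (hM I).2))

theorem rieszWeight_const_mul (c : ℝ) (M : FourAdic → ℝ) (I : FourAdic) :
    rieszWeight (fun J => c * M J) I = c * rieszWeight M I := by
  unfold rieszWeight dyLaplacian xMean
  ring

theorem IsSlicedSupermartingale.const_mul (hM : IsSlicedSupermartingale M) {c : ℝ} (hc : 0 ≤ c) :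
    IsSlicedSupermartingale fun I => c * M I := by
  intro I
  have hx : xMean (fun J => c * M J) I = c * xMean M I := by
    unfold xMean
    ring
  have hy : yMean (fun J => c * M J) I = c * yMean M I := by
    unfold yMean
    ring
  rw [hx, hy, (hM I).1]
  exact ⟨rfl, mul_le_mul_of_nonneg_left ((hM I).1 ▸ (hM I).2) hc⟩

theorem length_mul_exp_neg_xMean_mul_le_sum_energy (hM : ∀ I, xMean M I = yMean M I)
    (hU : IsSlicedMartingale U) (hV : IsSlicedMartingale V) (hUV : CauchyRiemann U V)
    (I : FourAdic) :
    I.length * (Real.exp (-xMean M I) * (U I ^ 2 + V I ^ 2)) ≤ ∑ j, energy M U V (I.child j) := by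
  have hVx : deltaX V I = -deltaY U I := by rw [(hUV I).2, neg_neg]
  have hsplit (x : ℝ) : Real.exp (-(xMean M I + x)) = Real.exp (-xMean M I) * Real.exp (-x) := by
    rw [neg_add, Real.exp_add]
  have hsplit' (x : ℝ) : Real.exp (-(xMean M I - x)) = Real.exp (-xMean M I) * Real.exp x := by
    rw [sub_eq_add_neg, hsplit, neg_neg]
  have hsum : ∑ j, energy M U V (I.child j) = I.length / 4 *
      ∑ j, Real.exp (-M (I.child j)) * (U (I.child j) ^ 2 + V (I.child j) ^ 2) := by
    simp only [energy, length_child, Finset.mul_sum]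
  have hpoint := mul_le_mul_of_nonneg_left
    (four_mul_le_sum_exp (U I) (V I) (deltaX U I) (deltaY U I) (deltaX M I) (deltaY M I))
    (mul_pos I.length_pos (Real.exp_pos (-xMean M I))).le
  rw [hsum, sum_child fun J => Real.exp (-M J) * (U J ^ 2 + V J ^ 2)]
  simp only [apply_xMinus, apply_xPlus, apply_yMinus, apply_yPlus, (hU I).1, (hU I).2, (hV I).1,
    (hV I).2, ← hM I, hsplit, hsplit', hVx, ← (hUV I).1]
  linear_combination hpoint / 4

theorem energy_add_rieszWeight_mul_le_sum_energy (hM : ∀ I, xMean M I = yMean M I)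
    (hU : IsSlicedMartingale U) (hV : IsSlicedMartingale V) (hUV : CauchyRiemann U V)
    (I : FourAdic) :
    energy M U V I + Real.exp (-M I) * (rieszWeight M I * (U I ^ 2 + V I ^ 2)) ≤
      ∑ j, energy M U V (I.child j) := by
  refine le_trans ?_ (length_mul_exp_neg_xMean_mul_le_sum_energy hM hU hV hUV I)
  have hexp : Real.exp (-M I) * (M I - xMean M I + 1) ≤ Real.exp (-xMean M I) := by
    have h := mul_le_mul_of_nonneg_left (Real.add_one_le_exp (M I - xMean M I))
      (Real.exp_pos (-M I)).le
    rwa [← Real.exp_add, neg_add_eq_sub, sub_sub_cancel_left] at h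
  calc energy M U V I + Real.exp (-M I) * (rieszWeight M I * (U I ^ 2 + V I ^ 2))
    _ = I.length * (Real.exp (-M I) * (M I - xMean M I + 1) * (U I ^ 2 + V I ^ 2)) := by
        unfold energy rieszWeight dyLaplacian
        ring
    _ ≤ _ := by gcongr; exact I.length_pos.le

theorem sum_levelSum_rieszWeight_mul_le_levelSum_energy (hM : ∀ I, xMean M I = yMean M I)
    (hU : IsSlicedMartingale U) (hV : IsSlicedMartingale V) (hUV : CauchyRiemann U V) (n : ℕ) :
    ∑ m ∈ Finset.range n, levelSum m
        (fun I => Real.exp (-M I) * (rieszWeight M I * (U I ^ 2 + V I ^ 2))) ≤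
      levelSum n (energy M U V) := by
  induction n with
  | zero => exact levelSum_nonneg fun I _ => energy_nonneg M U V I
  | succ n ih =>
    rw [Finset.sum_range_succ, levelSum_succ]
    refine (add_le_add_left ih _).trans ?_
    rw [← levelSum_add]
    exact levelSum_mono fun I _ => energy_add_rieszWeight_mul_le_sum_energy hM hU hV hUV I

variable {u v : ℝ → ℝ}

theorem IsSlicedSupermartingale.embedding_of_le_one (hM : IsSlicedSupermartingale M)
    (hM0 : ∀ I, 0 ≤ M I) (hM1 : ∀ I, M I ≤ 1) (h : MemHardy u v) :
    Summable (fun I => rieszWeight M I * (avg u I ^ 2 + avg v I ^ 2)) ∧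
      ∑' I, rieszWeight M I * (avg u I ^ 2 + avg v I ^ 2) ≤ Real.exp 1 * hardyNormSq u v := by
  have hterm (I : FourAdic) : 0 ≤ rieszWeight M I * (avg u I ^ 2 + avg v I ^ 2) :=
    mul_nonneg (rieszWeight_nonneg hM I) (by positivity)
  refine summable_and_tsum_le_of_sum_levelSum_le hterm fun n => ?_
  calc ∑ m ∈ Finset.range n, levelSum m (fun I => rieszWeight M I * (avg u I ^ 2 + avg v I ^ 2))
    _ ≤ ∑ m ∈ Finset.range n, levelSum m (fun I => Real.exp 1 *
          (Real.exp (-M I) * (rieszWeight M I * (avg u I ^ 2 + avg v I ^ 2)))) := by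
        refine Finset.sum_le_sum fun m _ => levelSum_mono fun I _ => ?_
        rw [← mul_assoc, ← Real.exp_add]
        exact le_mul_of_one_le_left (hterm I) (Real.one_le_exp (by linarith [hM1 I]))
    _ = Real.exp 1 * ∑ m ∈ Finset.range n, levelSum m (fun I =>
          Real.exp (-M I) * (rieszWeight M I * (avg u I ^ 2 + avg v I ^ 2))) := by
        simp only [levelSum_const_mul, Finset.mul_sum]
    _ ≤ Real.exp 1 * levelSum n (energy M (avg u) (avg v)) := by
        gcongr
        exact sum_levelSum_rieszWeight_mul_le_levelSum_energy (fun I => (hM I).1) h.sliced_re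
          h.sliced_im h.cauchyRiemann n
    _ ≤ Real.exp 1 * levelSum n (fun I => I.length * (avg u I ^ 2 + avg v I ^ 2)) := by
        gcongr
        refine levelSum_mono fun I _ => mul_le_mul_of_nonneg_left ?_ I.length_pos.le
        exact mul_le_of_le_one_left (by positivity) (Real.exp_le_one_iff.2 (by linarith [hM0 I]))
    _ ≤ Real.exp 1 * hardyNormSq u v := by
        gcongr
        exact h.levelSum_avg_sq_le n

theorem IsSlicedSupermartingale.embedding (hM : IsSlicedSupermartingale M) {K : ℝ}
    (hM0 : ∀ I, 0 ≤ M I) (hMK : ∀ I, M I ≤ K) (h : MemHardy u v) :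
    Summable (fun I => rieszWeight M I * (avg u I ^ 2 + avg v I ^ 2)) ∧
      ∑' I, rieszWeight M I * (avg u I ^ 2 + avg v I ^ 2) ≤
        Real.exp 1 * K * hardyNormSq u v := by
  have hK : 0 ≤ K := (hM0 root).trans (hMK root)
  -- If `K = 0`, then `M = 0`, so that `K * (K⁻¹ * M I) = M I` holds in this case, too.
  have hscale : M = fun I => K * (K⁻¹ * M I) := by
    funext I
    rcases hK.eq_or_lt with rfl | hpos
    · rw [zero_mul]
      exact le_antisymm (hMK I) (hM0 I)
    · rw [mul_inv_cancel_left₀ hpos.ne']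
  have hweight (I : FourAdic) : rieszWeight M I * (avg u I ^ 2 + avg v I ^ 2) =
      K * (rieszWeight (fun J => K⁻¹ * M J) I * (avg u I ^ 2 + avg v I ^ 2)) := by
    conv_lhs => rw [hscale, rieszWeight_const_mul, mul_assoc]
  obtain ⟨hs, hle⟩ := (hM.const_mul (inv_nonneg.2 hK)).embedding_of_le_one
    (fun I => mul_nonneg (inv_nonneg.2 hK) (hM0 I)) (fun I => inv_mul_le_one_of_le₀ (hMK I) hK) h
  simp only [hweight, tsum_mul_left]
  refine ⟨hs.mul_left K, (mul_le_mul_of_nonneg_left hle hK).trans_eq ?_⟩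
  ring

end Supermartingale

/-! ### Balanced sequences -/

/-- The supermartingale `I ↦ |I|⁻¹ ∑_{J ⊆ I} μ_J` attached to a summable sequence `μ`. -/
noncomputable def meanMass (μ : FourAdic → ℝ) (I : FourAdic) : ℝ :=
  1 / I.length * massIn μ I.toSet

section meanMass

variable {μ : FourAdic → ℝ}

theorem meanMass_nonneg (hμ : ∀ I, 0 ≤ μ I) (I : FourAdic) : 0 ≤ meanMass μ I :=
  mul_nonneg (one_div_pos.2 I.length_pos).le (massIn_nonneg hμ _)

theorem xMean_meanMass (hμ : Summable μ) (I : FourAdic) :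
    xMean (meanMass μ) I = 1 / (I.length / 2) * massIn μ I.xHalf := by
  rw [massIn_xHalf hμ, xMean, meanMass, meanMass]
  simp only [xPlus, xMinus, length_child]
  have := I.length_pos.ne'
  field_simp
  ring

theorem yMean_meanMass (hμ : Summable μ) (I : FourAdic) :
    yMean (meanMass μ) I = 1 / (I.length / 2) * massIn μ I.yHalf := by
  rw [massIn_yHalf hμ, yMean, meanMass, meanMass]
  simp only [yPlus, yMinus, length_child]
  have := I.length_pos.ne'
  field_simp
  ring

theorem meanMass_eq (hμ : Summable μ) (I : FourAdic) :
    meanMass μ I = μ I / I.length + (xMean (meanMass μ) I + yMean (meanMass μ) I) / 2 := by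
  rw [xMean_meanMass hμ, yMean_meanMass hμ, meanMass, massIn_toSet hμ]
  have := I.length_pos.ne'
  field_simp
  ring

theorem isBalanced_iff : IsBalanced μ ↔ (∀ I, 0 ≤ μ I) ∧ Summable μ ∧
    ∀ I, xMean (meanMass μ) I = yMean (meanMass μ) I := by
  refine ⟨fun h => ⟨h.nonneg, h.summable, fun I => ?_⟩, fun ⟨hμ, hs, h⟩ => ⟨hμ, hs, ?_, ?_⟩⟩
  · rw [xMean_meanMass h.summable, yMean_meanMass h.summable, h.x_eq_y]
  · intro I
    rw [← xMean_meanMass hs, ← yMean_meanMass hs, h]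
  · intro I
    have hI := meanMass_eq hs I
    rw [h] at hI
    rw [← yMean_meanMass hs, ← meanMass]
    linarith

theorem IsBalanced.xMean_meanMass_eq (hμ : IsBalanced μ) (I : FourAdic) :
    xMean (meanMass μ) I = meanMass μ I - μ I / I.length := by
  rw [xMean_meanMass hμ.summable, hμ.x_eq_y, hμ.y_eq, meanMass]

theorem IsBalanced.isSlicedSupermartingale (hμ : IsBalanced μ) :
    IsSlicedSupermartingale (meanMass μ) := by
  refine fun I => ⟨(isBalanced_iff.1 hμ).2.2 I, ?_⟩
  rw [hμ.xMean_meanMass_eq, sub_le_self_iff]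
  exact div_nonneg (hμ.nonneg I) I.length_pos.le

theorem IsBalanced.rieszWeight_meanMass (hμ : IsBalanced μ) : rieszWeight (meanMass μ) = μ := by
  funext I
  rw [rieszWeight, dyLaplacian, hμ.xMean_meanMass_eq, sub_sub_cancel_left, neg_neg,
    mul_div_cancel₀ _ I.length_pos.ne']

theorem IsBalanced.embedding (hμ : IsBalanced μ) {K : ℝ} (hK : Packing μ K) {u v : ℝ → ℝ}
    (h : MemHardy u v) :
    Summable (fun I => μ I * (avg u I ^ 2 + avg v I ^ 2)) ∧
      ∑' I, μ I * (avg u I ^ 2 + avg v I ^ 2) ≤ Real.exp 1 * K * hardyNormSq u v := by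
  have hembed := hμ.isSlicedSupermartingale.embedding (meanMass_nonneg hμ.nonneg) hK h
  rwa [hμ.rieszWeight_meanMass] at hembed

end meanMass

/-! ### Truncation at a finite level -/

section Truncation

variable {M U V : FourAdic → ℝ} {n : ℕ}

theorem FourAdic.level_le_of_toSet_subset {I J : FourAdic} (h : J.toSet ⊆ I.toSet) :
    I.level ≤ J.level := by
  rcases toSet_subset_toSet_iff.1 h with rfl | h | h
  · exact le_rfl
  · exact (lt_level_of_toSet_subset_yHalf h).le
  · exact (lt_level_of_toSet_subset_xHalf h).le

theorem rieszWeight_eq_zero_of_le_level (h0 : ∀ I, n ≤ I.level → M I = 0) {I : FourAdic}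
    (hI : n ≤ I.level) : rieszWeight M I = 0 := by
  have hchild (j : Fin 4) : M (I.child j) = 0 := h0 _ (Nat.le_succ_of_le hI)
  simp [rieszWeight, dyLaplacian, xMean, xPlus, xMinus, hchild, h0 I hI]

theorem summable_rieszWeight (hM : IsSlicedSupermartingale M)
    (h0 : ∀ I, n ≤ I.level → M I = 0) : Summable (rieszWeight M) := by
  rw [summable_iff_summable_levelSum (rieszWeight_nonneg hM)]
  refine summable_of_ne_finset_zero (s := Finset.range n) fun m hm => ?_
  exact Finset.sum_eq_zero fun _ _ =>
    rieszWeight_eq_zero_of_le_level h0 (not_lt.1 (Finset.mem_range.not.1 hm))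

theorem meanMass_rieszWeight (hM : IsSlicedSupermartingale M)
    (h0 : ∀ I, n ≤ I.level → M I = 0) : meanMass (rieszWeight M) = M := by
  funext I
  induction I using induction_of_level_ge n with
  | base I hI =>
    have hJ (J : {J : FourAdic // J.toSet ⊆ I.toSet}) : rieszWeight M J = 0 :=
      rieszWeight_eq_zero_of_le_level h0 (hI.trans (level_le_of_toSet_subset J.2))
    simp [meanMass, massIn, hJ, h0 I hI]
  | step I _ ih =>
    have hx : xMean (meanMass (rieszWeight M)) I = xMean M I := by
      simp only [xMean, xPlus, xMinus, ih]
    have hy : yMean (meanMass (rieszWeight M)) I = yMean M I := by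
      simp only [yMean, yPlus, yMinus, ih]
    rw [meanMass_eq (summable_rieszWeight hM h0), hx, hy, ← (hM I).1, rieszWeight, dyLaplacian,
      mul_div_cancel_left₀ _ I.length_pos.ne']
    ring

theorem isBalanced_rieszWeight (hM : IsSlicedSupermartingale M)
    (h0 : ∀ I, n ≤ I.level → M I = 0) : IsBalanced (rieszWeight M) := by
  refine isBalanced_iff.2 ⟨rieszWeight_nonneg hM, summable_rieszWeight hM h0, fun I => ?_⟩
  rw [meanMass_rieszWeight hM h0, (hM I).1]

/-- The supermartingale `M` killed after level `n`. -/
def killed (n : ℕ) (M : FourAdic → ℝ) (I : FourAdic) : ℝ :=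
  if I.level ≤ n then M I else 0

theorem killed_of_le {I : FourAdic} (hI : I.level ≤ n) : killed n M I = M I :=
  if_pos hI

theorem killed_of_lt {I : FourAdic} (hI : n < I.level) : killed n M I = 0 :=
  if_neg hI.not_ge

theorem killed_child_of_lt {I : FourAdic} (hI : I.level < n) (j : Fin 4) :
    killed n M (I.child j) = M (I.child j) :=
  killed_of_le hI

theorem killed_child_of_le {I : FourAdic} (hI : n ≤ I.level) (j : Fin 4) :
    killed n M (I.child j) = 0 :=
  killed_of_lt (Nat.lt_succ_of_le hI)

theorem IsSlicedSupermartingale.killed (hM : IsSlicedSupermartingale M) (hM0 : ∀ I, 0 ≤ M I)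
    (n : ℕ) : IsSlicedSupermartingale (killed n M) := by
  intro I
  rcases lt_or_ge I.level n with hI | hI
  · simpa only [xMean, yMean, xPlus, xMinus, yPlus, yMinus, killed_child_of_lt hI,
      killed_of_le hI.le] using hM I
  · simp only [xMean, yMean, xPlus, xMinus, yPlus, yMinus, killed_child_of_le hI, add_zero,
      zero_div, true_and]
    unfold DyadicHardy.killed
    split_ifs
    exacts [hM0 I, le_rfl]

theorem rieszWeight_killed {I : FourAdic} (hI : I.level < n) :
    rieszWeight (killed n M) I = rieszWeight M I := by
  simp only [rieszWeight, dyLaplacian, xMean, xPlus, xMinus, killed_child_of_lt hI,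
    killed_of_le hI.le]

theorem FourAdic.natFloor_pow_mul_of_mem_toSet {I : FourAdic} {m : ℕ} (hm : m ≤ I.level) {t : ℝ}
    (ht : t ∈ I.toSet) : ⌊4 ^ m * t⌋₊ = I.pos / 4 ^ (I.level - m) := by
  have hpow : (0 : ℝ) < 4 ^ m := by positivity
  have ht' := (toSet_subset_Ico_div_iff hm).2 ⟨le_rfl, Nat.lt_succ_self _⟩ ht
  rw [Nat.cast_succ] at ht'
  have hle := (div_le_iff₀' hpow).1 ht'.1
  exact (Nat.floor_eq_iff ((Nat.cast_nonneg _).trans hle)).2 ⟨hle, (lt_div_iff₀' hpow).1 ht'.2⟩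

theorem FourAdic.toSet_child_subset (I : FourAdic) (j : Fin 4) : (I.child j).toSet ⊆ I.toSet := by
  have hl := I.length_pos
  have hj : (j : ℝ) + 1 ≤ 4 := by exact_mod_cast j.isLt
  rw [toSet, toSet, left_child, length_child]
  exact Set.Ico_subset_Ico (le_add_of_nonneg_right (by positivity)) (by nlinarith)

/-- The step function on `[0, 1)` whose value on an interval `I` of level `n` is `U I`. -/
noncomputable def stepFn (n : ℕ) (U : FourAdic → ℝ) (t : ℝ) : ℝ :=
  if h : ⌊4 ^ n * t⌋₊ < 4 ^ n then U ⟨n, ⌊4 ^ n * t⌋₊, h⟩ else 0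

theorem stepFn_of_mem_toSet {I : FourAdic} (hI : I.level = n) {t : ℝ} (ht : t ∈ I.toSet) :
    stepFn n U t = U I := by
  subst hI
  have hfloor : ⌊4 ^ I.level * t⌋₊ = I.pos := by
    rw [natFloor_pow_mul_of_mem_toSet le_rfl ht, Nat.sub_self, pow_zero, Nat.div_one]
  simp only [stepFn, hfloor, I.pos_lt, dif_pos]

theorem stepFn_eq_stepFn_of_mem_toSet {I : FourAdic} (hI : n ≤ I.level) {s t : ℝ}
    (hs : s ∈ I.toSet) (ht : t ∈ I.toSet) : stepFn n U s = stepFn n U t := by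
  simp only [stepFn, natFloor_pow_mul_of_mem_toSet hI hs, natFloor_pow_mul_of_mem_toSet hI ht]

theorem measurable_stepFn (n : ℕ) (U : FourAdic → ℝ) : Measurable (stepFn n U) :=
  (measurable_from_top (f := fun k : ℕ => if h : k < 4 ^ n then U ⟨n, k, h⟩ else 0)).comp
    (Nat.measurable_floor.comp (measurable_const_mul _))

theorem abs_stepFn_le (n : ℕ) (U : FourAdic → ℝ) (t : ℝ) :
    |stepFn n U t| ≤ levelSum n fun I => |U I| := by
  unfold stepFn
  split_ifs with h
  · exact abs_le_levelSum_abs U ⟨n, _, h⟩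
  · rw [abs_zero]
    exact levelSum_nonneg fun I _ => abs_nonneg _

theorem memLp_stepFn (n : ℕ) (U : FourAdic → ℝ) :
    MemLp (stepFn n U) 2 (volume.restrict (Set.Ico 0 1)) :=
  .of_bound (measurable_stepFn n U).aestronglyMeasurable _ (.of_forall (abs_stepFn_le n U))

theorem integrableOn_stepFn (n : ℕ) (U : FourAdic → ℝ) (I : FourAdic) :
    IntegrableOn (stepFn n U) I.toSet :=
  IntegrableOn.mono_set ((memLp_stepFn n U).integrable one_le_two)
    (toSet_root ▸ I.toSet_subset_toSet_root)

theorem avg_stepFn (hU : IsSlicedMartingale U) {I : FourAdic} (hI : I.level ≤ n) :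
    avg (stepFn n U) I = U I := by
  induction I using induction_of_level_ge n with
  | base I hI' => exact avg_eq_of_forall_mem_eq fun t => stepFn_of_mem_toSet (hI.antisymm hI')
  | step I hI' ih =>
    rw [avg_eq_sum_child (integrableOn_stepFn n U I), Finset.sum_congr rfl fun j _ => ih j hI',
      sum_child_eq_means, (hU I).1, (hU I).2]
    ring

theorem avg_stepFn_child_of_lt (hU : IsSlicedMartingale U) {I : FourAdic} (hI : I.level < n)
    (j : Fin 4) : avg (stepFn n U) (I.child j) = U (I.child j) :=
  avg_stepFn hU hI

theorem avg_stepFn_child_of_le {I : FourAdic} (hI : n ≤ I.level) (j : Fin 4) :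
    avg (stepFn n U) (I.child j) = avg (stepFn n U) I := by
  have hleft : I.left ∈ I.toSet := Set.left_mem_Ico.2 (lt_add_of_pos_right _ I.length_pos)
  rw [avg_eq_of_forall_mem_eq fun t ht => stepFn_eq_stepFn_of_mem_toSet hI ht hleft]
  exact avg_eq_of_forall_mem_eq fun t ht =>
    stepFn_eq_stepFn_of_mem_toSet hI (I.toSet_child_subset j ht) hleft

theorem isSlicedMartingale_avg_stepFn (hU : IsSlicedMartingale U) (n : ℕ) :
    IsSlicedMartingale (avg (stepFn n U)) := by
  intro I
  rcases lt_or_ge I.level n with hI | hI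
  · simpa only [xMean, yMean, xPlus, xMinus, yPlus, yMinus, avg_stepFn_child_of_lt hU hI,
      avg_stepFn hU hI.le] using hU I
  · simp only [xMean, yMean, xPlus, xMinus, yPlus, yMinus, avg_stepFn_child_of_le hI,
      add_self_div_two, and_self]

theorem memHardy_stepFn (hU : IsSlicedMartingale U) (hV : IsSlicedMartingale V)
    (hUV : CauchyRiemann U V) (n : ℕ) : MemHardy (stepFn n U) (stepFn n V) where
  memLp_re := memLp_stepFn n U
  memLp_im := memLp_stepFn n V
  sliced_re := isSlicedMartingale_avg_stepFn hU n
  sliced_im := isSlicedMartingale_avg_stepFn hV n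
  cauchyRiemann I := by
    rcases lt_or_ge I.level n with hI | hI
    · simpa only [deltaX, deltaY, xPlus, xMinus, yPlus, yMinus, avg_stepFn_child_of_lt hU hI,
        avg_stepFn_child_of_lt hV hI] using hUV I
    · simp only [deltaX, deltaY, xPlus, xMinus, yPlus, yMinus, avg_stepFn_child_of_le hI,
        sub_self, zero_div, neg_zero, and_self]

theorem hardyNormSq_stepFn (hU : IsSlicedMartingale U) (hV : IsSlicedMartingale V)
    (hUV : CauchyRiemann U V) (n : ℕ) :
    hardyNormSq (stepFn n U) (stepFn n V) =
      levelSum n fun I => I.length * (U I ^ 2 + V I ^ 2) := by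
  have hsq (W : FourAdic → ℝ) {I : FourAdic} (hI : I.level = n) :
      ∫ t in I.toSet, stepFn n W t ^ 2 = I.length * W I ^ 2 := by
    rw [← length_mul_avg fun t => stepFn n W t ^ 2,
      avg_eq_of_forall_mem_eq fun t ht => by rw [stepFn_of_mem_toSet hI ht]]
  rw [(memHardy_stepFn hU hV hUV n).hardyNormSq_eq_levelSum n]
  exact levelSum_congr fun I hI => by rw [hsq U hI, hsq V hI, mul_add]

theorem exists_isBalanced_memHardy (hM : IsSlicedSupermartingale M) (hM0 : ∀ I, 0 ≤ M I) {K : ℝ}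
    (hMK : ∀ I, M I ≤ K) (hU : IsSlicedMartingale U) (hV : IsSlicedMartingale V)
    (hUV : CauchyRiemann U V) (n : ℕ) :
    ∃ μ, IsBalanced μ ∧ Packing μ K ∧ meanMass μ root = M root ∧
      ∃ u v, MemHardy u v ∧ avg v root = V root ∧
        hardyNormSq u v = levelSum n (fun I => I.length * (U I ^ 2 + V I ^ 2)) ∧
        ∑ m ∈ Finset.range n, levelSum m (fun I => rieszWeight M I * (U I ^ 2 + V I ^ 2)) ≤
          ∑' I, μ I * (avg u I ^ 2 + avg v I ^ 2) := by
  have hkilled := hM.killed hM0 n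
  have hzero (I : FourAdic) (hI : n + 1 ≤ I.level) : killed n M I = 0 := killed_of_lt hI
  have hμ := isBalanced_rieszWeight hkilled hzero
  have hmass := meanMass_rieszWeight hkilled hzero
  have hpacking : Packing (rieszWeight (killed n M)) K := fun I => by
    rw [← meanMass, hmass, killed]
    split_ifs
    exacts [hMK I, (hM0 I).trans (hMK I)]
  have hf := memHardy_stepFn hU hV hUV n
  refine ⟨_, hμ, hpacking, by rw [hmass, killed_of_le n.zero_le], _, _, hf,
    avg_stepFn hV n.zero_le, hardyNormSq_stepFn hU hV hUV n, ?_⟩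
  calc ∑ m ∈ Finset.range n, levelSum m (fun I => rieszWeight M I * (U I ^ 2 + V I ^ 2))
    _ = ∑ m ∈ Finset.range n, levelSum m (fun I => rieszWeight (killed n M) I *
          (avg (stepFn n U) I ^ 2 + avg (stepFn n V) I ^ 2)) := by
        refine Finset.sum_congr rfl fun m hm => levelSum_congr fun I hI => ?_
        have hlt : I.level < n := hI ▸ Finset.mem_range.1 hm
        rw [rieszWeight_killed hlt, avg_stepFn hU hlt.le, avg_stepFn hV hlt.le]
    _ ≤ _ := sum_levelSum_le_tsum
        (fun I => mul_nonneg (hμ.nonneg I) (by positivity)) (hμ.embedding hpacking hf).1 n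

end Truncation

/-! ### The extremal walk -/

section Walk

open Filter Topology

/-- The state of the recursion `step` with initial state `s` at the interval of level `n` and
position `k`. -/
def recState {σ : Type*} (step : σ → Fin 4 → σ) (s : σ) : ℕ → ℕ → σ
  | 0, _ => s
  | n + 1, k => step (recState step s n (k / 4)) ⟨k % 4, Nat.mod_lt _ (by norm_num)⟩

/-- The family on the 4-adic tree with value `s` at the root in which `step` computes the values
at the quarters of an interval from the value at the interval. -/
def childRec {σ : Type*} (step : σ → Fin 4 → σ) (s : σ) (I : FourAdic) : σ :=
  recState step s I.level I.pos

theorem childRec_root {σ : Type*} (step : σ → Fin 4 → σ) (s : σ) : childRec step s root = s := rfl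

theorem childRec_child {σ : Type*} (step : σ → Fin 4 → σ) (s : σ) (I : FourAdic) (j : Fin 4) :
    childRec step s (I.child j) = step (childRec step s I) j := by
  have hdiv : (4 * I.pos + j) / 4 = I.pos := by omega
  have hmod : (4 * I.pos + j) % 4 = j := by omega
  simp only [childRec, child, recState, hdiv, hmod]

theorem childRec_induction {σ : Type*} {step : σ → Fin 4 → σ} {s : σ} {P : σ → Prop} (hs : P s)
    (hstep : ∀ s j, P s → P (step s j)) (I : FourAdic) : P (childRec step s I) := by
  have h (n k : ℕ) : P (recState step s n k) := by
    induction n generalizing k with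
    | zero => exact hs
    | succ n ih => exact hstep _ _ (ih _)
  exact h _ _

/-- The factor `e ^ (1 / N)` by which the discount of the energy changes when the height drops
by one. -/
noncomputable def growth (N : ℕ) : ℝ := Real.exp (1 / N)

/-- The relative increment `tanh (1 / (2 * N))` of the analytic martingale, for which the
four-point inequality is an equality. -/
noncomputable def tilt (N : ℕ) : ℝ := (growth N - 1) / (growth N + 1)

/-- The probability `(1 - tilt N ^ 2) / 4` that the lazy walk moves up. -/
noncomputable def rate (N : ℕ) : ℝ := growth N / (growth N + 1) ^ 2

/-- One step of the extremal walk from the height `k` and the value `z` of the analytic martingale: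
the walk stops at height `0` and goes down on all quarters at height `N`; in between, the first two
quarters are those of `I^y`, on which the height is kept. -/
noncomputable def walkStep (N : ℕ) : ℕ × ℂ → Fin 4 → ℕ × ℂ
  | (0, z), _ => (0, z)
  | (k + 1, z), j =>
    if k + 1 = N then (k, z)
    else ![(k + 1, (1 - tilt N * Complex.I) * z), (k + 1, (1 + tilt N * Complex.I) * z),
      (k, (1 - tilt N) * z), (k + 2, (1 + tilt N) * z)] j

/-- The extremal walk: the height, in units of `1 / N`, and the value of the analytic
martingale. -/
noncomputable def walk (N : ℕ) : FourAdic → ℕ × ℂ := childRec (walkStep N) (N, 1)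

/-- The supermartingale of the extremal walk. -/
noncomputable def walkHeight (N : ℕ) (I : FourAdic) : ℝ := (walk N I).1 / N

/-- The real part of the analytic martingale of the extremal walk. -/
noncomputable def walkRe (N : ℕ) (I : FourAdic) : ℝ := (walk N I).2.re

/-- The imaginary part of the analytic martingale of the extremal walk. -/
noncomputable def walkIm (N : ℕ) (I : FourAdic) : ℝ := (walk N I).2.im

/-- The indicator function of the top height `N`. -/
def topHeight (N k : ℕ) : ℝ := if k = N then 1 else 0

variable {N : ℕ}

theorem growth_pos (N : ℕ) : 0 < growth N := Real.exp_pos _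

theorem one_le_growth (N : ℕ) : 1 ≤ growth N := Real.one_le_exp (by positivity)

theorem growth_pow_self (hN : 0 < N) : growth N ^ N = Real.exp 1 := by
  rw [growth, ← Real.exp_nat_mul, mul_one_div_cancel (by positivity)]

theorem tilt_sq (N : ℕ) : tilt N ^ 2 = 1 - 4 * rate N := by
  have := growth_pos N
  unfold tilt rate
  field_simp
  ring

theorem growth_mul_one_sub_tilt_sq (N : ℕ) : growth N * (1 - tilt N) ^ 2 = 4 * rate N := by
  have := growth_pos N
  unfold tilt rate
  field_simp
  ring

theorem one_add_tilt_sq (N : ℕ) : (1 + tilt N) ^ 2 = 4 * rate N * growth N := by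
  have := growth_pos N
  unfold tilt rate
  field_simp
  ring

theorem rate_pos (N : ℕ) : 0 < rate N := by
  have := growth_pos N
  unfold rate
  positivity

theorem rate_le_one_fourth (N : ℕ) : rate N ≤ 1 / 4 := by
  linear_combination (1 / 4 : ℝ) * sq_nonneg (tilt N) + (1 / 4 : ℝ) * tilt_sq N

theorem walk_root (N : ℕ) : walk N root = (N, 1) := childRec_root _ _

theorem walk_child (N : ℕ) (I : FourAdic) (j : Fin 4) :
    walk N (I.child j) = walkStep N (walk N I) j :=
  childRec_child _ _ I j

theorem walk_fst_le (N : ℕ) (I : FourAdic) : (walk N I).1 ≤ N := by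
  refine childRec_induction (P := fun s : ℕ × ℂ => s.1 ≤ N) le_rfl ?_ I
  rintro ⟨_ | k, z⟩ j (hk : _ ≤ N)
  · exact hk
  · rw [walkStep]
    split_ifs with htop
    · exact k.le_succ.trans hk
    · fin_cases j <;> dsimp <;> omega

theorem walkStep_fst_x_add (hN : 0 < N) (s : ℕ × ℂ) :
    ((walkStep N s 3).1 + (walkStep N s 2).1 : ℝ) = 2 * (s.1 - topHeight N s.1) := by
  rcases s with ⟨_ | k, z⟩
  · simp [walkStep, topHeight, hN.ne]
  · by_cases hk : k + 1 = N
    · simp only [walkStep, topHeight, if_pos hk]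
      push_cast
      ring
    · simp only [walkStep, topHeight, if_neg hk, Matrix.cons_val]
      push_cast
      ring

theorem walkStep_fst_y_add (hN : 0 < N) (s : ℕ × ℂ) :
    ((walkStep N s 1).1 + (walkStep N s 0).1 : ℝ) = 2 * (s.1 - topHeight N s.1) := by
  rcases s with ⟨_ | k, z⟩
  · simp [walkStep, topHeight, hN.ne]
  · by_cases hk : k + 1 = N
    · simp only [walkStep, topHeight, if_pos hk]
      push_cast
      ring
    · simp only [walkStep, topHeight, if_neg hk, Matrix.cons_val]
      push_cast
      ring

theorem walkStep_snd_x_add (N : ℕ) (s : ℕ × ℂ) :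
    (walkStep N s 3).2 + (walkStep N s 2).2 = 2 * s.2 := by
  rcases s with ⟨_ | k, z⟩
  · exact (two_mul z).symm
  · by_cases hk : k + 1 = N
    · simp only [walkStep, if_pos hk, two_mul]
    · simp only [walkStep, if_neg hk, Matrix.cons_val]
      ring

theorem walkStep_snd_y_add (N : ℕ) (s : ℕ × ℂ) :
    (walkStep N s 1).2 + (walkStep N s 0).2 = 2 * s.2 := by
  rcases s with ⟨_ | k, z⟩
  · exact (two_mul z).symm
  · by_cases hk : k + 1 = N
    · simp only [walkStep, if_pos hk, two_mul]
    · simp only [walkStep, if_neg hk, Matrix.cons_val]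
      ring

theorem walkStep_snd_y_sub (N : ℕ) (s : ℕ × ℂ) :
    (walkStep N s 1).2 - (walkStep N s 0).2 =
      Complex.I * ((walkStep N s 3).2 - (walkStep N s 2).2) := by
  rcases s with ⟨_ | k, z⟩
  · simp [walkStep]
  · by_cases hk : k + 1 = N
    · simp [walkStep, hk]
    · simp only [walkStep, if_neg hk, Matrix.cons_val]
      ring

theorem xMean_walkHeight (hN : 0 < N) (I : FourAdic) :
    xMean (walkHeight N) I = walkHeight N I - 1 / N * topHeight N (walk N I).1 := by
  simp only [xMean, xPlus, xMinus, walkHeight, walk_child, ← add_div, walkStep_fst_x_add hN]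
  ring

theorem yMean_walkHeight (hN : 0 < N) (I : FourAdic) :
    yMean (walkHeight N) I = walkHeight N I - 1 / N * topHeight N (walk N I).1 := by
  simp only [yMean, yPlus, yMinus, walkHeight, walk_child, ← add_div, walkStep_fst_y_add hN]
  ring

theorem topHeight_nonneg (N k : ℕ) : 0 ≤ topHeight N k := by
  unfold topHeight
  split_ifs <;> norm_num

theorem isSlicedSupermartingale_walkHeight (hN : 0 < N) :
    IsSlicedSupermartingale (walkHeight N) := by
  intro I
  rw [xMean_walkHeight hN, yMean_walkHeight hN, sub_le_self_iff]
  exact ⟨rfl, mul_nonneg (by positivity) (topHeight_nonneg _ _)⟩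

theorem walkHeight_nonneg (N : ℕ) (I : FourAdic) : 0 ≤ walkHeight N I := by
  unfold walkHeight
  positivity

theorem walkHeight_le_one (N : ℕ) (I : FourAdic) : walkHeight N I ≤ 1 :=
  div_le_one_of_le₀ (Nat.cast_le.2 (walk_fst_le N I)) N.cast_nonneg

theorem walkHeight_root (hN : 0 < N) : walkHeight N root = 1 := by
  rw [walkHeight, walk_root, div_self (by positivity)]

theorem rieszWeight_walkHeight (hN : 0 < N) (I : FourAdic) :
    rieszWeight (walkHeight N) I = I.length * (1 / N * topHeight N (walk N I).1) := by
  rw [rieszWeight, dyLaplacian, xMean_walkHeight hN, sub_sub_cancel_left, neg_neg]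

theorem isSlicedMartingale_walkRe (N : ℕ) : IsSlicedMartingale (walkRe N) := by
  intro I
  have hx := congrArg Complex.re (walkStep_snd_x_add N (walk N I))
  have hy := congrArg Complex.re (walkStep_snd_y_add N (walk N I))
  simp only [Complex.add_re, Complex.mul_re, Complex.re_ofNat, Complex.im_ofNat] at hx hy
  simp only [xMean, yMean, xPlus, xMinus, yPlus, yMinus, walkRe, walk_child, hx, hy]
  exact ⟨by ring, by ring⟩

theorem isSlicedMartingale_walkIm (N : ℕ) : IsSlicedMartingale (walkIm N) := by
  intro I
  have hx := congrArg Complex.im (walkStep_snd_x_add N (walk N I))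
  have hy := congrArg Complex.im (walkStep_snd_y_add N (walk N I))
  simp only [Complex.add_im, Complex.mul_im, Complex.re_ofNat, Complex.im_ofNat] at hx hy
  simp only [xMean, yMean, xPlus, xMinus, yPlus, yMinus, walkIm, walk_child, hx, hy]
  exact ⟨by ring, by ring⟩

theorem cauchyRiemann_walk (N : ℕ) : CauchyRiemann (walkRe N) (walkIm N) := by
  intro I
  have hre := congrArg Complex.re (walkStep_snd_y_sub N (walk N I))
  have him := congrArg Complex.im (walkStep_snd_y_sub N (walk N I))
  simp only [Complex.sub_re, Complex.sub_im, Complex.I_mul_re, Complex.I_mul_im] at hre him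
  simp only [deltaX, deltaY, xPlus, xMinus, yPlus, yMinus, walkRe, walkIm, walk_child, hre, him,
    true_and]
  exact neg_div _ _

/-! ### The energy of the extremal walk -/

/-- The generator of the height under the energy-weighted measure: a lazy simple random walk,
stopped at `0`, which from the height `N` moves down while its mass is multiplied by `growth N`. -/
noncomputable def walkOp (N : ℕ) (g : ℕ → ℝ) : ℕ → ℝ
  | 0 => g 0
  | k + 1 =>
    if k + 1 = N then growth N * g k
    else g (k + 1) + rate N * (g (k + 2) + g k - 2 * g (k + 1))

/-- The energy of a state of the extremal walk, discounted by its height. -/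
noncomputable def stateEnergy (N : ℕ) (s : ℕ × ℂ) : ℝ := Complex.normSq s.2 / growth N ^ s.1

/-- The mean over level `m` of the function `g` of the height, weighted by the discounted energy. -/
noncomputable def energyMean (N m : ℕ) (g : ℕ → ℝ) : ℝ :=
  levelSum m fun I => I.length * (stateEnergy N (walk N I) * g (walk N I).1)

theorem stateEnergy_nonneg (N : ℕ) (s : ℕ × ℂ) : 0 ≤ stateEnergy N s :=
  div_nonneg (Complex.normSq_nonneg _) (pow_nonneg (growth_pos N).le _)

theorem sum_stateEnergy_walkStep_mul (N : ℕ) (g : ℕ → ℝ) (s : ℕ × ℂ) :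
    ∑ j, stateEnergy N (walkStep N s j) * g (walkStep N s j).1 =
      4 * (stateEnergy N s * walkOp N g s.1) := by
  have hx := (growth_pos N).ne'
  rcases s with ⟨_ | k, z⟩
  · simp [walkStep, walkOp]
  · by_cases hk : k + 1 = N
    · simp only [walkStep, walkOp, stateEnergy, if_pos hk, Finset.sum_const, Finset.card_univ,
        Fintype.card_fin, nsmul_eq_mul]
      push_cast
      field_simp
      ring
    · have hnormSq : Complex.normSq (1 - tilt N * Complex.I) = 1 + tilt N ^ 2 ∧
          Complex.normSq (1 + tilt N * Complex.I) = 1 + tilt N ^ 2 ∧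
          Complex.normSq (1 - tilt N) = (1 - tilt N) ^ 2 ∧
          Complex.normSq (1 + tilt N) = (1 + tilt N) ^ 2 := by
        simp [Complex.normSq_apply, sq]
      obtain ⟨hy₀, hy₁, hx₀, hx₁⟩ := hnormSq
      simp only [Fin.sum_univ_four, walkStep, walkOp, stateEnergy, if_neg hk, Matrix.cons_val,
        map_mul, hy₀, hy₁, hx₀, hx₁, pow_succ]
      field_simp
      linear_combination Complex.normSq z * (2 * growth N * g (k + 1) * tilt_sq N +
        growth N * g k * growth_mul_one_sub_tilt_sq N + g (k + 2) * one_add_tilt_sq N)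

theorem energyMean_zero (hN : 0 < N) (g : ℕ → ℝ) :
    energyMean N 0 g = g N / Real.exp 1 := by
  rw [energyMean, levelSum_zero, walk_root, length_root, stateEnergy, growth_pow_self hN, map_one]
  ring

theorem energyMean_succ (N m : ℕ) (g : ℕ → ℝ) :
    energyMean N (m + 1) g = energyMean N m (walkOp N g) := by
  rw [energyMean, levelSum_succ]
  refine levelSum_congr fun I _ => ?_
  simp only [walk_child, length_child, ← Finset.mul_sum, sum_stateEnergy_walkStep_mul]
  ring

theorem energyMean_mono (N m : ℕ) {g h : ℕ → ℝ} (hgh : ∀ k ≤ N, g k ≤ h k) :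
    energyMean N m g ≤ energyMean N m h :=
  levelSum_mono fun I _ => mul_le_mul_of_nonneg_left
    (mul_le_mul_of_nonneg_left (hgh _ (walk_fst_le N I)) (stateEnergy_nonneg _ _)) I.length_pos.le

theorem energyMean_nonneg (N m : ℕ) {g : ℕ → ℝ} (hg : ∀ k ≤ N, 0 ≤ g k) :
    0 ≤ energyMean N m g :=
  levelSum_nonneg fun I _ => mul_nonneg I.length_pos.le
    (mul_nonneg (stateEnergy_nonneg _ _) (hg _ (walk_fst_le N I)))

theorem energyMean_add (N m : ℕ) (g h : ℕ → ℝ) :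
    energyMean N m (fun k => g k + h k) = energyMean N m g + energyMean N m h := by
  simp only [energyMean, mul_add, levelSum_add]

theorem energyMean_const_mul (N m : ℕ) (c : ℝ) (g : ℕ → ℝ) :
    energyMean N m (fun k => c * g k) = c * energyMean N m g := by
  simp only [energyMean, ← levelSum_const_mul]
  exact levelSum_congr fun I _ => by ring

/-- The mean loss `N - growth N * (N - 1)` of the energy-weighted height at the top. -/
noncomputable def heightLoss (N : ℕ) : ℝ := N - growth N * (N - 1)

theorem heightLoss_pos (hN : 0 < N) : 0 < heightLoss N := by
  have hN' : (0 : ℝ) < N := by positivity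
  have hexp := mul_lt_mul_of_pos_left
    (Real.add_one_lt_exp (neg_ne_zero.2 (one_div_pos.2 hN').ne')) (mul_pos hN' (growth_pos N))
  rw [Real.exp_neg, ← growth, mul_inv_cancel_right₀ (growth_pos N).ne'] at hexp
  have hloss : N * growth N * (-(1 / N) + 1) = growth N * (N - 1) := by
    field_simp
    ring
  rw [heightLoss]
  linarith

theorem walkOp_one (hN : 0 < N) (k : ℕ) :
    walkOp N (fun _ => 1) k = 1 + (growth N - 1) * topHeight N k := by
  rcases k with _ | k
  · simp [walkOp, topHeight, hN.ne]
  · by_cases hk : k + 1 = N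
    · simp only [walkOp, topHeight, if_pos hk]
      ring
    · simp only [walkOp, topHeight, if_neg hk]
      ring

theorem walkOp_natCast (hN : 0 < N) (k : ℕ) :
    walkOp N (fun k => k) k = k + -heightLoss N * topHeight N k := by
  rcases k with _ | k
  · simp [walkOp, topHeight, hN.ne]
  · by_cases hk : k + 1 = N
    · subst hk
      simp [walkOp, topHeight, heightLoss]
    · simp only [walkOp, topHeight, if_neg hk]
      push_cast
      ring

theorem energyMean_eq_of_walkOp_eq (hN : 0 < N) {g : ℕ → ℝ} {c : ℝ}
    (hg : ∀ k, walkOp N g k = g k + c * topHeight N k) (n : ℕ) :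
    energyMean N n g =
      g N / Real.exp 1 + c * ∑ m ∈ Finset.range n, energyMean N m (topHeight N) := by
  induction n with
  | zero => simp [energyMean_zero hN]
  | succ n ih =>
    rw [energyMean_succ, funext hg, energyMean_add, energyMean_const_mul, ih,
      Finset.sum_range_succ]
    ring

theorem walkOp_potential_add_le (hN : 0 < N) {k : ℕ} (hk : k ≤ N) :
    walkOp N (fun k => k * (N - k) + (N + 1) / heightLoss N * k) k + 2 * rate N / N * k ≤
      k * (N - k) + (N + 1) / heightLoss N * k := by
  have hW := heightLoss_pos hN
  have hN' : (0 : ℝ) < N := by positivity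
  have hr := rate_le_one_fourth N
  have hr0 := rate_pos N
  rcases k with _ | k
  · simp [walkOp]
  · by_cases htop : k + 1 = N
    · have hkN : (k : ℝ) = N - 1 := eq_sub_of_add_eq (by exact_mod_cast htop)
      have hcancel : (N + 1) / heightLoss N * heightLoss N = N + 1 :=
        div_mul_cancel₀ _ hW.ne'
      have hloss : growth N * (N - 1) = N - heightLoss N := (sub_sub_cancel _ _).symm
      have hrate : 2 * rate N / N * N = 2 * rate N := div_mul_cancel₀ _ hN'.ne'
      simp only [walkOp, if_pos htop]
      push_cast
      rw [hkN, sub_add_cancel, sub_sub_cancel]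
      linear_combination (1 + (N + 1) / heightLoss N) * hloss - hcancel + hrate + 2 * hr + hW
    · simp only [walkOp, if_neg htop]
      have hrate : 2 * rate N / N * (k + 1 : ℕ) ≤ 2 * rate N := by
        rw [div_mul_eq_mul_div]
        exact div_le_of_le_mul₀ hN'.le (by positivity)
          (mul_le_mul_of_nonneg_left (Nat.cast_le.2 hk) (by positivity))
      push_cast at hrate ⊢
      linear_combination hrate

theorem tendsto_energyMean_natCast (hN : 0 < N) :
    Tendsto (fun n => energyMean N n fun k => k) atTop (𝓝 0) := by
  have hc : 0 < 2 * rate N / N := div_pos (mul_pos two_pos (rate_pos N)) (by positivity)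
  let g : ℕ → ℝ := fun k => k * (N - k) + (N + 1) / heightLoss N * k
  have hg0 (k : ℕ) (hk : k ≤ N) : 0 ≤ g k := by
    have hkN : (k : ℝ) ≤ N := by exact_mod_cast hk
    have := (heightLoss_pos hN).le
    have := sub_nonneg.2 hkN
    positivity
  have hh (n : ℕ) : 0 ≤ energyMean N n fun k => k := energyMean_nonneg N n fun k _ => k.cast_nonneg
  have hstep (n : ℕ) : energyMean N (n + 1) g + 2 * rate N / N * energyMean N n (fun k => k) ≤
      energyMean N n g := by
    rw [energyMean_succ, ← energyMean_const_mul, ← energyMean_add]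
    exact energyMean_mono N n fun k hk => walkOp_potential_add_le hN hk
  have hsum (n : ℕ) : ∑ m ∈ Finset.range n, 2 * rate N / N * energyMean N m (fun k => k) ≤
      energyMean N 0 g - energyMean N n g := by
    induction n with
    | zero => simp
    | succ n ih =>
      rw [Finset.sum_range_succ]
      linarith [hstep n]
  have hsummable := summable_of_sum_range_le (fun n => mul_nonneg hc.le (hh n))
    fun n => (hsum n).trans (sub_le_self _ (energyMean_nonneg N n hg0))
  exact ((summable_mul_left_iff hc.ne').1 hsummable).tendsto_atTop_zero

/-- The total energy gained at the top height before level `n`. -/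
noncomputable def topEnergy (N n : ℕ) : ℝ := ∑ m ∈ Finset.range n, energyMean N m (topHeight N)

theorem sum_rieszWeight_walkHeight (hN : 0 < N) (n : ℕ) :
    ∑ m ∈ Finset.range n, levelSum m
      (fun I => rieszWeight (walkHeight N) I * (walkRe N I ^ 2 + walkIm N I ^ 2)) =
      Real.exp 1 / N * topEnergy N n := by
  rw [topEnergy, Finset.mul_sum]
  refine Finset.sum_congr rfl fun m _ => ?_
  rw [energyMean, ← levelSum_const_mul]
  refine levelSum_congr fun I _ => ?_
  rw [rieszWeight_walkHeight hN, walkRe, walkIm, stateEnergy, Complex.normSq_apply, topHeight]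
  split_ifs with hI
  · rw [hI, growth_pow_self hN]
    field_simp
  · ring

theorem levelSum_walk_sq_le (hN : 0 < N) (n : ℕ) :
    levelSum n (fun I => I.length * (walkRe N I ^ 2 + walkIm N I ^ 2)) ≤
      energyMean N n (fun _ => 1) + (Real.exp 1 - 1) * energyMean N n (fun k => k) := by
  have hexp : (1 : ℝ) ≤ Real.exp 1 := Real.one_le_exp zero_le_one
  have hpow (k : ℕ) (hk : k ≤ N) : growth N ^ k ≤ 1 + (Real.exp 1 - 1) * k := by
    rcases k with _ | k
    · simp
    · have hk1 : (1 : ℝ) ≤ (k + 1 : ℕ) := by exact_mod_cast k.succ_pos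
      calc growth N ^ (k + 1) ≤ Real.exp 1 :=
            growth_pow_self hN ▸ pow_le_pow_right₀ (one_le_growth N) hk
        _ ≤ 1 + (Real.exp 1 - 1) * (k + 1 : ℕ) := by
            linarith [mul_le_mul_of_nonneg_left hk1 (sub_nonneg.2 hexp)]
  calc levelSum n (fun I => I.length * (walkRe N I ^ 2 + walkIm N I ^ 2))
      = energyMean N n (fun k => growth N ^ k) := levelSum_congr fun I _ => by
        rw [stateEnergy, div_mul_cancel₀ _ (pow_pos (growth_pos N) _).ne', Complex.normSq_apply,
          walkRe, walkIm, sq, sq]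
    _ ≤ energyMean N n (fun k => 1 + (Real.exp 1 - 1) * k) := energyMean_mono N n hpow
    _ = _ := by rw [energyMean_add, energyMean_const_mul]

theorem tendsto_topEnergy (hN : 0 < N) :
    Tendsto (topEnergy N) atTop (𝓝 (N / (Real.exp 1 * heightLoss N))) := by
  have hW := (heightLoss_pos hN).ne'
  have hlim := ((tendsto_energyMean_natCast hN).const_sub (N / Real.exp 1)).div_const (heightLoss N)
  rw [sub_zero, div_div] at hlim
  refine hlim.congr fun n => ?_
  rw [energyMean_eq_of_walkOp_eq hN (walkOp_natCast hN), ← topEnergy]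
  field_simp
  ring

theorem tendsto_energyMean_one (hN : 0 < N) :
    Tendsto (fun n => energyMean N n fun _ => 1) atTop
      (𝓝 (growth N / (Real.exp 1 * heightLoss N))) := by
  have hW := (heightLoss_pos hN).ne'
  have hlim := ((tendsto_topEnergy hN).const_mul (growth N - 1)).const_add (1 / Real.exp 1)
  have hvalue : 1 / Real.exp 1 + (growth N - 1) * (N / (Real.exp 1 * heightLoss N)) =
      growth N / (Real.exp 1 * heightLoss N) := by
    field_simp
    rw [heightLoss]
    ring
  rw [hvalue] at hlim
  exact hlim.congr fun n => (energyMean_eq_of_walkOp_eq hN (walkOp_one hN) n).symm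

theorem exists_mul_levelSum_lt_sum_rieszWeight (hN : 0 < N) {C : ℝ} (hC0 : 0 ≤ C)
    (hC : C * growth N < Real.exp 1) :
    ∃ n, C * levelSum n (fun I => I.length * (walkRe N I ^ 2 + walkIm N I ^ 2)) <
      ∑ m ∈ Finset.range n, levelSum m
        (fun I => rieszWeight (walkHeight N) I * (walkRe N I ^ 2 + walkIm N I ^ 2)) := by
  have hW := heightLoss_pos hN
  have hN' : (N : ℝ) ≠ 0 := by positivity
  have hnorm := ((tendsto_energyMean_one hN).add
    ((tendsto_energyMean_natCast hN).const_mul (Real.exp 1 - 1))).const_mul C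
  have hgain := (tendsto_topEnergy hN).const_mul (Real.exp 1 / N)
  have hlt : C * (growth N / (Real.exp 1 * heightLoss N) + (Real.exp 1 - 1) * 0) <
      Real.exp 1 / N * (N / (Real.exp 1 * heightLoss N)) := by
    have hlimit : Real.exp 1 / N * (N / (Real.exp 1 * heightLoss N)) =
        Real.exp 1 / (Real.exp 1 * heightLoss N) := by field_simp
    rw [hlimit, mul_zero, add_zero, ← mul_div_assoc]
    exact div_lt_div_of_pos_right hC (by positivity)
  obtain ⟨n, hn⟩ := (hnorm.eventually_lt hgain hlt).exists
  refine ⟨n, (mul_le_mul_of_nonneg_left (levelSum_walk_sq_le hN n) hC0).trans_lt ?_⟩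
  rwa [sum_rieszWeight_walkHeight hN]

theorem exists_mul_growth_lt {C : ℝ} (hC : C < Real.exp 1) :
    ∃ N : ℕ, 0 < N ∧ C * growth N < Real.exp 1 := by
  have hgrowth : Tendsto growth atTop (𝓝 1) :=
    Real.exp_zero ▸ (Real.continuous_exp.tendsto 0).comp tendsto_one_div_atTop_nhds_zero_nat
  have hlim := hgrowth.const_mul C
  rw [mul_one] at hlim
  exact ((eventually_gt_atTop 0).and (hlim.eventually_lt_const hC)).exists

end Walk

theorem exists_isBalanced_mul_hardyNormSq_lt {C : ℝ} (hC : C < Real.exp 1) :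
    ∃ μ, IsBalanced μ ∧ Packing μ 1 ∧ meanMass μ root = 1 ∧ ∃ u v, MemHardy u v ∧
      avg v root = 0 ∧ C * hardyNormSq u v < ∑' I, μ I * (avg u I ^ 2 + avg v I ^ 2) := by
  obtain ⟨N, hN, hCN⟩ := exists_mul_growth_lt (max_lt hC (Real.exp_pos 1))
  obtain ⟨n, hn⟩ := exists_mul_levelSum_lt_sum_rieszWeight hN (le_max_right C 0) hCN
  obtain ⟨μ, hμ, hpack, hroot, u, v, huv, hv, hnorm, hsum⟩ :=
    exists_isBalanced_memHardy (isSlicedSupermartingale_walkHeight hN) (walkHeight_nonneg N)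
      (walkHeight_le_one N) (isSlicedMartingale_walkRe N) (isSlicedMartingale_walkIm N)
      (cauchyRiemann_walk N) n
  have hnorm0 : 0 ≤ hardyNormSq u v := integral_nonneg fun t => by positivity
  refine ⟨μ, hμ, hpack, hroot.trans (walkHeight_root hN), u, v, huv, ?_, ?_⟩
  · rw [hv, walkIm, walk_root, Complex.one_im]
  · calc C * hardyNormSq u v ≤ max C 0 * hardyNormSq u v :=
          mul_le_mul_of_nonneg_right (le_max_left C 0) hnorm0
      _ < _ := (hnorm ▸ hn).trans_le hsum

end DyadicHardy

theorem mainTheorem1 :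
    -- the embedding for a bounded non-negative sliced supermartingale
    (∀ M : FourAdic → ℝ, IsSlicedSupermartingale M → (∀ I, 0 ≤ M I) → BddAbove (Set.range M) →
      ∀ u v : ℝ → ℝ, MemHardy u v →
        Summable (fun I => rieszWeight M I * (avg u I ^ 2 + avg v I ^ 2)) ∧
        ∑' I, rieszWeight M I * (avg u I ^ 2 + avg v I ^ 2) ≤
          Real.exp 1 * (⨆ I, |M I|) * hardyNormSq u v) ∧
    -- its constant is sharp
    (∀ C : ℝ, C < Real.exp 1 →
      ∃ M : FourAdic → ℝ, IsSlicedSupermartingale M ∧ (∀ I, 0 ≤ M I) ∧ BddAbove (Set.range M) ∧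
      ∃ u v : ℝ → ℝ, MemHardy u v ∧ avg v FourAdic.root = 0 ∧
        C * (⨆ I, |M I|) * hardyNormSq u v <
          ∑' I, rieszWeight M I * (avg u I ^ 2 + avg v I ^ 2)) ∧
    -- the embedding for a balanced sequence with a packing condition
    (∀ (μ : FourAdic → ℝ) (K : ℝ), IsBalanced μ → Packing μ K →
      ∀ u v : ℝ → ℝ, MemHardy u v →
        Summable (fun I => μ I * (avg u I ^ 2 + avg v I ^ 2)) ∧
        ∑' I, μ I * (avg u I ^ 2 + avg v I ^ 2) ≤ Real.exp 1 * K * hardyNormSq u v) ∧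
    -- its constant is sharp
    (∀ C : ℝ, C < Real.exp 1 →
      ∃ (μ : FourAdic → ℝ) (K : ℝ), IsBalanced μ ∧ Packing μ K ∧
      ∃ u v : ℝ → ℝ, MemHardy u v ∧ avg v FourAdic.root = 0 ∧
        C * K * hardyNormSq u v < ∑' I, μ I * (avg u I ^ 2 + avg v I ^ 2)) := by
  refine ⟨fun M hM hM0 hbdd u v huv => ?_, fun C hC => ?_,
    fun μ K hμ hK u v huv => hμ.embedding hK huv, fun C hC => ?_⟩
  · have hle (I : FourAdic) : M I ≤ ⨆ I, |M I| := by
      simpa only [abs_of_nonneg (hM0 _)] using le_ciSup hbdd I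
    exact hM.embedding hM0 hle huv
  · obtain ⟨μ, hμ, hpack, hroot, u, v, huv, hv, hlt⟩ := exists_isBalanced_mul_hardyNormSq_lt hC
    have hbdd : BddAbove (Set.range (meanMass μ)) := ⟨1, Set.forall_mem_range.2 hpack⟩
    have : Nonempty FourAdic := ⟨FourAdic.root⟩
    have hsup : ⨆ I, |meanMass μ I| = 1 := by
      simp only [abs_of_nonneg (meanMass_nonneg hμ.nonneg _)]
      exact le_antisymm (ciSup_le hpack) (hroot ▸ le_ciSup hbdd FourAdic.root)
    refine ⟨meanMass μ, hμ.isSlicedSupermartingale, meanMass_nonneg hμ.nonneg, hbdd, u, v, huv,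
      hv, ?_⟩
    simpa only [hsup, mul_one, hμ.rieszWeight_meanMass] using hlt
  · obtain ⟨μ, hμ, hpack, -, u, v, huv, hv, hlt⟩ := exists_isBalanced_mul_hardyNormSq_lt hC
    exact ⟨μ, 1, hμ, hpack, u, v, huv, hv, by rwa [mul_one]⟩
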